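/- Let $n\ge 1$ be an integer and let $\mathbb{N}^n$ be the $n$-th power of the set of positive integers with the product order. Let $\mathscr{I\!P\!F}(\mathbb{N}^n)$ be the semigroup of all order isomorphisms between principal filters ${\uparrow}x=\{z\in\mathbb{N}^n : x\le z\}$ of $\mathbb{N}^n$, with composition of partial maps (written from left to right) as the operation. For a permutation $\sigma$ of $\{1,\dots,n\}$ put $(z)\sigma=(z_{(1)\sigma^{-1}},\dots,z_{(n)\sigma^{-1}})$, and let $\mathscr{S}_n\ltimes\mathbb{Z}^n$ be the semidirect product with multiplication $(\sigma,z)(\tau,v)=(\sigma\tau,(z)\tau+v)$, where $\sigma\tau$ means first $\sigma$, then $\tau$. Every $\alpha\in\mathscr{I\!P\!F}(\mathbb{N}^n)$ has the form $(z)\alpha=(z-x_\alpha)\sigma_\alpha+y_\alpha$ with uniquely determined $\sigma_\alpha\in\mathscr{S}_n$ and $x_\alpha,y_\alpha\in\mathbb{N}^n$ such that $\operatorname{dom}\alpha={\uparrow}x_\alpha$ and $\operatorname{ran}\alpha={\uparrow}y_\alpha$; let $\Upsilon\colon\mathscr{I\!P\!F}(\mathbb{N}^n)\to\mathscr{S}_n\ltimes\mathbb{Z}^n$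 be the homomorphism $\Upsilon(\alpha)=(\sigma_\alpha,(x_\alpha)\sigma_\alpha-y_\alpha)$. Let $S$ be a Hausdorff topological semigroup (that is, its multiplication is jointly continuous) which satisfies one of the following conditions: (i) $S$ is compact; (ii) $S$ is $\Gamma$-compact, i.e. for every $x\in S$ the closure of $\{x,x^2,x^3,\dots\}$ is compact; (iii) $S$ is a countably compact topological inverse semigroup, i.e. every $x\in S$ has a unique $x^{-1}\in S$ with $xx^{-1}x=x$ and $x^{-1}xx^{-1}=x^{-1}$, and the map $x\mapsto x^{-1}$ is continuous; (iv) the square $S\times S$ is countably compact; (v) the square $S\times S$ is a Tychonoff pseudocompact space, i.e. it is Tychonoff and every continuous real-valued function on it is bounded. Then $S$ has no subsemigroup isomorphic to $\mathscr{I\!P\!F}(\mathbb{N}^n)$, and for every semigroup homomorphism $h\colon\mathscr{I\!P\!F}(\mathbb{N}^n)\to S$ the image of $h$ is a subgroup of $S$ (a subsemigroup that is a group under the operation of $S$). Moreover, for every homomorphism $h\colon\mathscr{I\!P\!F}(\mathbb{N}^n)\to S$ there is a unique semigroup homomorphism $u\colon\mathscr{S}_n\ltimes\mathbb{Z}^n\to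 S$ such that $u\circ\Upsilon=h$. -/

import Mathlib

/-! ### The semigroup of order isomorphisms between principal filters of `ℕ+ ^ n` -/

/-- A partial injective self-map `f` of `ℕ+ ^ n` (with the product order) is an order isomorphism
between principal filters: its domain and its range are principal filters `{z | x ≤ z}` and
`{z | y ≤ z}`, and `f` preserves and reflects the order on its domain. -/
def IsFilterIso {n : ℕ} (f : (Fin n → ℕ+) ≃. (Fin n → ℕ+)) : Prop :=
  (∃ x, ∀ z, (∃ w, w ∈ f z) ↔ x ≤ z) ∧
  (∃ y, ∀ w, (∃ z, w ∈ f z) ↔ y ≤ w) ∧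
  ∀ z z' w w', w ∈ f z → w' ∈ f z' → (z ≤ z' ↔ w ≤ w')

theorem IsFilterIso.trans {n : ℕ} {f g : (Fin n → ℕ+) ≃. (Fin n → ℕ+)}
    (hf : IsFilterIso f) (hg : IsFilterIso g) : IsFilterIso (f.trans g) := by
  obtain ⟨⟨x, hx⟩, ⟨y, hy⟩, h⟩ := hf
  obtain ⟨⟨u, hu⟩, ⟨v, hv⟩, k⟩ := hg
  obtain ⟨a, ha⟩ := (hy (y ⊔ u)).2 le_sup_left
  obtain ⟨b, hb⟩ := (hu (y ⊔ u)).2 le_sup_right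
  refine ⟨⟨a, fun z => ?_⟩, ⟨b, fun w => ?_⟩, fun z z' w w' h1 h2 => ?_⟩
  · constructor
    · rintro ⟨w, hw⟩
      obtain ⟨m, hm, hm'⟩ := (PEquiv.mem_trans f g z w).1 hw
      exact (h _ _ _ _ ha hm).2 (sup_le ((hy m).1 ⟨z, hm⟩) ((hu m).1 ⟨w, hm'⟩))
    · intro haz
      obtain ⟨m, hm⟩ := (hx z).2 (((hx a).1 ⟨_, ha⟩).trans haz)
      obtain ⟨w, hw⟩ := (hu m).2 (le_sup_right.trans ((h _ _ _ _ ha hm).1 haz))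
      exact ⟨w, (PEquiv.mem_trans f g z w).2 ⟨m, hm, hw⟩⟩
  · constructor
    · rintro ⟨z, hw⟩
      obtain ⟨m, hm, hm'⟩ := (PEquiv.mem_trans f g z w).1 hw
      exact (k _ _ _ _ hb hm').1 (sup_le ((hy m).1 ⟨z, hm⟩) ((hu m).1 ⟨w, hm'⟩))
    · intro hbw
      obtain ⟨m, hm⟩ := (hv w).2 (((hv b).1 ⟨_, hb⟩).trans hbw)
      obtain ⟨z, hz⟩ := (hy m).2 (le_sup_left.trans ((k _ _ _ _ hb hm).2 hbw))
      exact ⟨z, (PEquiv.mem_trans f g z w).2 ⟨m, hz, hm⟩⟩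
  · obtain ⟨m, hm, hm'⟩ := (PEquiv.mem_trans f g z w).1 h1
    obtain ⟨l, hl, hl'⟩ := (PEquiv.mem_trans f g z' w').1 h2
    exact (h _ _ _ _ hm hl).trans (k _ _ _ _ hm' hl')

/-- The set of all order isomorphisms between principal filters of `ℕ+ ^ n`. -/
def IPF (n : ℕ) : Type :=
  {f : (Fin n → ℕ+) ≃. (Fin n → ℕ+) // IsFilterIso f}

/-- The semigroup operation is the composition of partial maps, written from left to right:
`z (α * β) = (z α) β` whenever the right-hand side is defined. -/
instance IPF.instSemigroup (n : ℕ) : Semigroup (IPF n) where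
  mul α β := ⟨α.1.trans β.1, α.2.trans β.2⟩
  mul_assoc α β γ := Subtype.ext (PEquiv.trans_assoc α.1 β.1 γ.1)

/-! ### The group `S_n ⋉ ℤ^n` -/

/-- The underlying set of the semidirect product of `ℤ ^ n` by the symmetric group. -/
@[ext]
structure SymZ (n : ℕ) where
  perm : Equiv.Perm (Fin n)
  vec : Fin n → ℤ

/-- Coordinate permutation `(z)σ = (z_{(1)σ⁻¹}, …, z_{(n)σ⁻¹})`. -/
def permVec {n : ℕ} {R : Type*} (z : Fin n → R) (σ : Equiv.Perm (Fin n)) : Fin n → R :=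
  fun i => z (σ.symm i)

/-- The product `(σ, z) (τ, v) = (σ τ, (z)τ + v)`, where permutations act on the right, so that
`σ τ` means first `σ`, then `τ`. -/
instance SymZ.instGroup (n : ℕ) : Group (SymZ n) where
  mul a b := ⟨a.perm.trans b.perm, permVec a.vec b.perm + b.vec⟩
  one := ⟨Equiv.refl _, 0⟩
  inv a := ⟨a.perm.symm, -permVec a.vec a.perm.symm⟩
  mul_assoc a b c := by
    refine SymZ.ext rfl (funext fun i => ?_)
    change a.vec _ + b.vec _ + c.vec i = a.vec _ + (b.vec _ + c.vec i)
    rw [add_assoc]; rfl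
  one_mul a := SymZ.ext rfl (funext fun i => zero_add (a.vec i))
  mul_one a := SymZ.ext rfl (funext fun i => add_zero (a.vec i))
  inv_mul_cancel a := by
    refine SymZ.ext (Equiv.symm_trans_self _) (funext fun i => ?_)
    change -a.vec (a.perm (a.perm.symm i)) + a.vec i = 0
    simp

theorem SymZ.perm_mul {n : ℕ} (a b : SymZ n) : (a * b).perm = a.perm.trans b.perm := rfl

theorem SymZ.vec_mul {n : ℕ} (a b : SymZ n) :
    (a * b).vec = permVec a.vec b.perm + b.vec := rfl

/-! ### The canonical homomorphism `IPF n → S_n ⋉ ℤ^n` -/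

theorem orderIso_single {n : ℕ} (φ : (Fin n → ℕ) ≃o (Fin n → ℕ)) (i : Fin n) :
    ∃ j, φ (Pi.single i 1) = Pi.single j 1 := by
  have hat : ∀ a : ℕ, IsAtom a ↔ a = 1 := by
    intro a
    constructor
    · intro h
      have h0 : a ≠ 0 := h.1
      by_contra h1
      have := h.2 1 (by omega)
      simp at this
    · rintro rfl
      refine ⟨by simp, fun b hb => ?_⟩
      rw [Nat.bot_eq_zero]; omega
  have h1 : IsAtom (Pi.single i 1 : Fin n → ℕ) :=
    Pi.isAtom_iff_eq_single.2 ⟨i, 1, (hat 1).2 rfl, rfl⟩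
  obtain ⟨j, a, ha, h⟩ := Pi.isAtom_iff_eq_single.1 ((φ.isAtom_iff _).2 h1)
  rw [(hat a).1 ha] at h
  exact ⟨j, h⟩

theorem orderIso_le {n : ℕ} (φ : (Fin n → ℕ) ≃o (Fin n → ℕ)) (s t : Fin n → Fin n)
    (ht : ∀ j, φ.symm (Pi.single j 1) = Pi.single (t j) 1)
    (hst : ∀ j, s (t j) = j) (v : Fin n → ℕ) (i : Fin n) : v i ≤ φ v (s i) := by
  have supp : ∀ k j, j ≠ s i → φ (Pi.single i k) j = 0 := by
    intro k j hj
    by_contra h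
    have h1 : (Pi.single j 1 : Fin n → ℕ) ≤ φ (Pi.single i k) := by
      intro l
      by_cases hl : l = j
      · subst hl; simp; omega
      · simp [hl]
    have h2 := φ.symm.monotone h1 (t j)
    rw [ht, φ.symm_apply_apply] at h2
    by_cases hi : t j = i
    · exact hj (by rw [← hi, hst])
    · simp [hi] at h2
  have grow : ∀ k, k ≤ φ (Pi.single i k) (s i) := by
    intro k
    induction k with
    | zero => simp
    | succ k ih =>
      have hlt : (Pi.single i k : Fin n → ℕ) < Pi.single i (k + 1) := by
        refine Pi.lt_def.2 ⟨fun l => ?_, i, by simp⟩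
        by_cases hl : l = i
        · subst hl; simp
        · simp [hl]
      obtain ⟨-, j, hj⟩ := Pi.lt_def.1 (φ.strictMono hlt)
      by_cases h : j = s i
      · subst h; omega
      · rw [supp _ _ h, supp _ _ h] at hj; omega
  have hle : (Pi.single i (v i) : Fin n → ℕ) ≤ v := by
    intro l
    by_cases hl : l = i
    · subst hl; simp
    · simp [hl]
  exact (grow _).trans (φ.monotone hle (s i))

/-- Every order automorphism of `ℕ ^ n` permutes the coordinates. -/
theorem orderIso_perm {n : ℕ} (φ : (Fin n → ℕ) ≃o (Fin n → ℕ)) :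
    ∃ σ : Equiv.Perm (Fin n), ∀ v i, φ v i = v (σ.symm i) := by
  choose s hs using orderIso_single φ
  choose t ht using orderIso_single φ.symm
  have single_inj : ∀ i j : Fin n, (Pi.single i 1 : Fin n → ℕ) = Pi.single j 1 → i = j := by
    intro i j h
    by_contra hij
    have := congrFun h i
    simp [hij] at this
  have hst : ∀ j, s (t j) = j := fun j =>
    single_inj _ _ (by rw [← hs, ← ht, φ.apply_symm_apply])
  have hts : ∀ j, t (s j) = j := fun j =>
    single_inj _ _ (by rw [← ht, ← hs, φ.symm_apply_apply])
  refine ⟨⟨s, t, hts, hst⟩, fun v i => le_antisymm ?_ ?_⟩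
  · have := orderIso_le φ.symm t s hs hts (φ v) i
    rwa [φ.symm_apply_apply] at this
  · have := orderIso_le φ s t ht hst v (t i)
    rwa [hst] at this

namespace IPF

variable {n : ℕ} (α : IPF n)

/-- The generator of the domain: `dom α = {z | α.src ≤ z}`. -/
noncomputable def src : Fin n → ℕ+ := α.2.1.choose

/-- The generator of the range: `ran α = {w | α.tgt ≤ w}`. -/
noncomputable def tgt : Fin n → ℕ+ := α.2.2.1.choose

theorem mem_dom_iff (z : Fin n → ℕ+) : (∃ w, w ∈ α.1 z) ↔ α.src ≤ z := α.2.1.choose_spec z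

theorem mem_ran_iff (w : Fin n → ℕ+) : (∃ z, w ∈ α.1 z) ↔ α.tgt ≤ w := α.2.2.1.choose_spec w

theorem mul_mem_iff (α β : IPF n) (z w : Fin n → ℕ+) :
    w ∈ (α * β).1 z ↔ ∃ m, m ∈ α.1 z ∧ w ∈ β.1 m := PEquiv.mem_trans α.1 β.1 z w

/-- Translate a vector of natural numbers by a vector of positive integers. -/
def shift (x : Fin n → ℕ+) (v : Fin n → ℕ) : Fin n → ℕ+ := fun i => ⟨x i + v i, by positivity⟩

theorem le_shift (x : Fin n → ℕ+) (v : Fin n → ℕ) : x ≤ shift x v := by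
  intro i
  rw [← PNat.coe_le_coe]
  simp [shift]

theorem shift_sub {x z : Fin n → ℕ+} (h : x ≤ z) :
    shift x (fun i => (z i : ℕ) - (x i : ℕ)) = z := by
  funext i
  have : (x i : ℕ) ≤ z i := h i
  apply PNat.coe_injective
  simp only [shift, PNat.mk_coe]
  omega

theorem sub_shift (x : Fin n → ℕ+) (v : Fin n → ℕ) :
    (fun i => (shift x v i : ℕ) - (x i : ℕ)) = v := by
  funext i
  simp [shift]

theorem shift_le_iff (x : Fin n → ℕ+) (v w : Fin n → ℕ) : shift x v ≤ shift x w ↔ v ≤ w := by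
  refine forall_congr' fun i => ?_
  rw [← PNat.coe_le_coe]
  simp [shift]

/-- In coordinates, `α` is `z ↦ (z - α.src)σ + α.tgt` for a permutation `σ`. -/
theorem exists_perm : ∃ σ : Equiv.Perm (Fin n), ∀ z w, w ∈ α.1 z →
    ∀ i, (w i : ℤ) = permVec (fun j => (z j : ℤ) - α.src j) σ i + α.tgt i := by
  have hmap : ∀ v : Fin n → ℕ, ∃ w, w ∈ α.1 (shift α.src v) := fun v =>
    (α.mem_dom_iff _).2 (le_shift _ _)
  have hinv : ∀ v : Fin n → ℕ, ∃ z, shift α.tgt v ∈ α.1 z := fun v =>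
    (α.mem_ran_iff _).2 (le_shift _ _)
  choose F hF using hmap
  choose G hG using hinv
  have hFt : ∀ v, α.tgt ≤ F v := fun v => (α.mem_ran_iff _).1 ⟨_, hF v⟩
  have hGs : ∀ v, α.src ≤ G v := fun v => (α.mem_dom_iff _).1 ⟨_, hG v⟩
  let φ : (Fin n → ℕ) ≃o (Fin n → ℕ) :=
    { toFun := fun v i => (F v i : ℕ) - (α.tgt i : ℕ)
      invFun := fun v i => (G v i : ℕ) - (α.src i : ℕ)
      left_inv := by
        intro v
        have h1 := hG (fun i => (F v i : ℕ) - (α.tgt i : ℕ))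
        rw [shift_sub (hFt v)] at h1
        have h2 := α.1.inj h1 (hF v)
        change (fun i => (G _ i : ℕ) - (α.src i : ℕ)) = v
        rw [h2, sub_shift]
      right_inv := by
        intro v
        have h1 := hF (fun i => (G v i : ℕ) - (α.src i : ℕ))
        rw [shift_sub (hGs v)] at h1
        have h2 := Option.mem_unique h1 (hG v)
        change (fun i => (F _ i : ℕ) - (α.tgt i : ℕ)) = v
        rw [h2, sub_shift]
      map_rel_iff' := by
        intro v w
        change ((fun i => (F v i : ℕ) - (α.tgt i : ℕ)) ≤ fun i => (F w i : ℕ) - (α.tgt i : ℕ)) ↔ _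
        rw [← shift_le_iff α.tgt, shift_sub (hFt v), shift_sub (hFt w),
          ← α.2.2.2 _ _ _ _ (hF v) (hF w), shift_le_iff] }
  obtain ⟨σ, hσ⟩ := orderIso_perm φ
  refine ⟨σ, fun z w hw i => ?_⟩
  have hz : α.src ≤ z := (α.mem_dom_iff z).1 ⟨w, hw⟩
  have h1 := hF (fun i => (z i : ℕ) - (α.src i : ℕ))
  rw [shift_sub hz] at h1
  have h2 := Option.mem_unique h1 hw
  have h3 : (F (fun i => (z i : ℕ) - (α.src i : ℕ)) i : ℕ) - (α.tgt i : ℕ) = _ :=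
    hσ (fun i => (z i : ℕ) - (α.src i : ℕ)) i
  rw [h2] at h3
  have h4 : (α.tgt i : ℕ) ≤ w i := (α.mem_ran_iff w).1 ⟨z, hw⟩ i
  have h5 : (α.src (σ.symm i) : ℕ) ≤ z (σ.symm i) := hz _
  simp only [permVec]
  omega

/-- The permutation `σ_α` for which `α` is `z ↦ (z - α.src)σ_α + α.tgt`. -/
noncomputable def perm : Equiv.Perm (Fin n) := α.exists_perm.choose

theorem perm_spec {z w : Fin n → ℕ+} (h : w ∈ α.1 z) (i : Fin n) :
    (w i : ℤ) = permVec (fun j => (z j : ℤ) - α.src j) α.perm i + α.tgt i :=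
  α.exists_perm.choose_spec z w h i

/-- The permutation is determined by the displacement vectors of `α`. -/
theorem perm_unique {σ : Equiv.Perm (Fin n)} {c : Fin n → ℤ}
    (hσ : ∀ z w, w ∈ α.1 z → ∀ i, (w i : ℤ) = (z (σ.symm i) : ℤ) - c i) : σ = α.perm := by
  have key : ∀ i, σ.symm i = α.perm.symm i := by
    intro i
    obtain ⟨w, hw⟩ := (α.mem_dom_iff _).2 (le_shift α.src 0)
    obtain ⟨w', hw'⟩ := (α.mem_dom_iff _).2 (le_shift α.src (Pi.single (σ.symm i) 1))
    have a1 := hσ _ _ hw i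
    have a2 := hσ _ _ hw' i
    have b1 := α.perm_spec hw i
    have b2 := α.perm_spec hw' i
    by_contra hne
    have hne' : α.perm.symm i ≠ σ.symm i := fun h => hne h.symm
    have e0 : ∀ j, ((shift α.src 0 j : ℕ) : ℤ) = α.src j := fun j => by simp [shift]
    have e1 : ((shift α.src (Pi.single (σ.symm i) 1) (σ.symm i) : ℕ) : ℤ) =
        α.src (σ.symm i) + 1 := by simp [shift]
    have e2 : ((shift α.src (Pi.single (σ.symm i) 1) (α.perm.symm i) : ℕ) : ℤ) =
        α.src (α.perm.symm i) := by
      simp only [shift, PNat.mk_coe, Pi.single_eq_of_ne hne']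
      simp
    simp only [permVec] at b1 b2
    rw [e0] at a1 b1
    rw [e1] at a2
    rw [e2] at b2
    linarith
  exact Equiv.symm_bijective.injective (Equiv.ext key)

/-- The map `Υ : α ↦ (σ_α, (x_α)σ_α - y_α)`, where `dom α = {z | x_α ≤ z}` and
`ran α = {w | y_α ≤ w}`. -/
noncomputable def upsilonFun (α : IPF n) : SymZ n where
  perm := α.perm
  vec := permVec (fun j => (α.src j : ℤ)) α.perm - fun j => (α.tgt j : ℤ)

theorem upsilonFun_spec (α : IPF n) {z w : Fin n → ℕ+} (h : w ∈ α.1 z) (i : Fin n) :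
    (w i : ℤ) = (z (α.perm.symm i) : ℤ) - α.upsilonFun.vec i := by
  rw [α.perm_spec h i]
  simp only [upsilonFun, permVec, Pi.sub_apply]
  ring

theorem upsilonFun_mul (α β : IPF n) :
    (α * β).upsilonFun = α.upsilonFun * β.upsilonFun := by
  have hcomp : ∀ z w, w ∈ (α * β).1 z → ∀ i, (w i : ℤ) =
      (z ((α.perm.trans β.perm).symm i) : ℤ) - (α.upsilonFun * β.upsilonFun).vec i := by
    intro z w hw i
    obtain ⟨m, hm, hm'⟩ := (mul_mem_iff α β z w).1 hw
    rw [β.upsilonFun_spec hm' i, α.upsilonFun_spec hm (β.perm.symm i), SymZ.vec_mul]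
    change (z _ : ℤ) - _ - _ = (z (α.perm.symm (β.perm.symm i)) : ℤ) -
      (α.upsilonFun.vec (β.perm.symm i) + β.upsilonFun.vec i)
    ring
  have hperm := (α * β).perm_unique hcomp
  refine SymZ.ext hperm.symm (funext fun i => ?_)
  obtain ⟨w, hw⟩ := ((α * β).mem_dom_iff _).2 le_rfl
  have h1 := hcomp _ _ hw i
  have h2 := (α * β).upsilonFun_spec hw i
  rw [← hperm] at h2
  omega

/-- The canonical homomorphism `Υ` from `IPF n` to `S_n ⋉ ℤ^n`. -/
noncomputable def upsilon (n : ℕ) : IPF n →ₙ* SymZ n where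
  toFun := upsilonFun
  map_mul' := upsilonFun_mul

end IPF

/-! ### Compactness-type conditions on topological semigroups -/

/-- A subsemigroup is a subgroup if it is a group under the induced operation. -/
def IsSubgroupOf {S : Type*} [Semigroup S] (G : Subsemigroup S) : Prop :=
  ∃ e ∈ G, ∀ a ∈ G, e * a = a ∧ a * e = a ∧ ∃ b ∈ G, a * b = e ∧ b * a = e

/-- The set `{x, x², x³, …}` of all positive powers of `x`. -/
def positivePowers {S : Type*} [Semigroup S] (x : S) : Set S :=
  Set.range fun k : ℕ => (fun y => y * x)^[k] x

/-- For every `x` the closure of `{x, x², x³, …}` is compact. -/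
def IsGammaCompact (S : Type*) [Semigroup S] [TopologicalSpace S] : Prop :=
  ∀ x : S, IsCompact (closure (positivePowers x))

/-- `y` is an inverse of `x` in the sense of semigroup theory. -/
def IsSemigroupInverse {S : Type*} [Semigroup S] (x y : S) : Prop :=
  x * y * x = x ∧ y * x * y = y

/-- `S` is an inverse semigroup (every element has a unique inverse) whose inversion is
continuous. -/
def IsTopologicalInverse (S : Type*) [Semigroup S] [TopologicalSpace S] : Prop :=
  (∀ x : S, ∃! y, IsSemigroupInverse x y) ∧
  ∃ inv : S → S, (∀ x, IsSemigroupInverse x (inv x)) ∧ Continuous inv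

/-- `X` is Tychonoff and every continuous real-valued function on `X` is bounded. -/
def IsTychonoffPseudocompact (X : Type*) [TopologicalSpace X] : Prop :=
  T35Space X ∧ ∀ f : X → ℝ, Continuous f → ∃ C : ℝ, ∀ x, |f x| ≤ C

/-!
The monoid `IPF n` is full of one-sided inverses: if `p` is the translation of `ℕ+ ^ n` onto a
principal filter `{z | x ≤ z}` and `q` is its inverse partial map, then `p * q = 1`, while `q * p`
is the identity map of `{z | x ≤ z}`. The pair `p, q` generates a copy of the bicyclic monoid, and
under each of the five conditions a homomorphism `h` into `S` must collapse it, `h (q * p) = h 1`.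

* Suppose that `h (p ^ k)` and `h (q ^ k)` converge to `a` and `b` along a common filter. Each
  `a * h (q ^ k)` is a limit of positive powers of `h p`, so it absorbs `h (q * p)` on the right;
  hence so does `a * b = h 1` (`map_mul_eq_map_one_of_tendsto_pow`). Such a filter exists under the
  first four conditions; for a countably compact topological inverse semigroup, `h (q ^ k)` is the
  inverse of `h (p ^ k)`, so it converges along with it.
* If `S × S` is Tychonoff and pseudocompact, Glicksberg's lemma (`eventually_forall_abs_sub_le`)
  makes `x ↦ φ (x * ·)` continuous for the uniform norm, for every continuous `φ : S → ℝ`. By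
  pseudocompactness there are `k < l` such that the functions given by `h (p ^ k)` and `h (p ^ l)`
  are uniformly close; multiplication on the right by `h (q ^ k)` turns the two elements into `h 1`
  and a positive power of `h p`, so that `φ (h 1)` and `φ (h (q * p))` are close
  (`map_mul_eq_map_one_of_isTychonoffPseudocompact`).

Consequently `h` sends every idempotent of `IPF n` to `h 1` (`IPF.map_mul_symm`), so that its image
is a group. Two elements with the same image under `Υ` agree on a common principal filter, hence
have the same image under `h` (`IPF.map_eq_of_upsilon_eq`); as `Υ` is surjective, `h` factors
uniquely through it. Since `Υ` is not injective for `1 ≤ n`, neither is `h`.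
-/

/-! ### Pseudocompact products -/

open Filter Topology in
/-- In a completely regular pseudocompact space, every sequence of nonempty open sets accumulates
at some point: otherwise the sequence is locally finite, and a sum of bump functions of heights
`0, 1, 2, …` supported in its members is continuous and unbounded. -/
theorem exists_frequently_inter_nonempty {X : Type*} [TopologicalSpace X]
    [CompletelyRegularSpace X]
    (hX : ∀ f : X → ℝ, Continuous f → ∃ C : ℝ, ∀ x, |f x| ≤ C)
    (O : ℕ → Set X) (hO : ∀ k, IsOpen (O k)) (hne : ∀ k, (O k).Nonempty) :
    ∃ x, ∀ N ∈ 𝓝 x, ∃ᶠ k in atTop, (O k ∩ N).Nonempty := by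
  by_contra! hcon
  have hlf : LocallyFinite O := by
    intro x
    obtain ⟨N, hN, hfin⟩ := hcon x
    refine ⟨N, hN, ?_⟩
    rw [← Nat.cofinite_eq_atTop, eventually_cofinite] at hfin
    simpa only [Set.nonempty_iff_ne_empty] using hfin
  choose x hx using hne
  choose g hgc hg0 hg1 using fun k =>
    CompletelyRegularSpace.completely_regular_isOpen (x k) (O k) (hO k) (hx k)
  let G : ℕ → X → ℝ := fun k y => k * (1 - (g k y : ℝ))
  have hGs : ∀ k, Function.support (G k) ⊆ O k := by
    intro k y hy
    by_contra hyO
    exact hy (by simp [G, hg1 k hyO])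
  have hGlf : LocallyFinite fun k => Function.support (G k) := hlf.subset hGs
  have hGc : ∀ k, Continuous (G k) := fun k => by
    have := hgc k
    fun_prop
  obtain ⟨C, hC⟩ := hX _ (continuous_finsum hGc hGlf)
  obtain ⟨k, hk⟩ := exists_nat_gt C
  have hnonneg : ∀ j, 0 ≤ G j (x k) := fun j =>
    mul_nonneg (Nat.cast_nonneg j) (sub_nonneg.2 (g j (x k)).2.2)
  have hle : G k (x k) ≤ ∑ᶠ j, G j (x k) :=
    single_le_finsum k (hGlf.point_finite (x k)) hnonneg
  have hGk : G k (x k) = k := by simp [G, hg0]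
  have := (le_abs_self _).trans (hC (x k))
  linarith

open Filter Topology in
/-- Glicksberg's lemma: on a pseudocompact Tychonoff product, a continuous real function varies
continuously in its first variable, uniformly over the second one. If this fails at `x₀`, there
are shrinking neighbourhoods `W k` of `x₀` and open boxes `U k ×ˢ V k` with `U (k + 1) ⊆ W k` over
which `f` differs by more than `ε` from its values on `W (k + 1) ×ˢ V k`; such boxes cannot
accumulate at a point where `f` is continuous. -/
theorem eventually_forall_abs_sub_le {X Y : Type*} [TopologicalSpace X] [TopologicalSpace Y]
    (hXY : IsTychonoffPseudocompact (X × Y)) {f : X × Y → ℝ} (hf : Continuous f) (x₀ : X)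
    {ε : ℝ} (hε : 0 < ε) : ∀ᶠ x in 𝓝 x₀, ∀ y, |f (x, y) - f (x₀, y)| ≤ ε := by
  obtain ⟨ht, hb⟩ := hXY
  by_contra hcon
  simp only [not_eventually, not_forall, not_le] at hcon
  have step : ∀ W : {W : Set X // W ∈ 𝓝 x₀}, ∃ (U : Set X) (V : Set Y)
      (W' : {W : Set X // W ∈ 𝓝 x₀}), IsOpen U ∧ U.Nonempty ∧ IsOpen V ∧ V.Nonempty ∧
      U ⊆ W.1 ∧ W'.1 ⊆ W.1 ∧
      ∀ u ∈ U, ∀ w ∈ W'.1, ∀ v ∈ V, ε < |f (u, v) - f (w, v)| := by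
    rintro ⟨W, hW⟩
    obtain ⟨x, ⟨y, hxy⟩, hxW⟩ := (hcon.and_eventually (eventually_mem_nhds_iff.2 hW)).exists
    have hopen : IsOpen {t : X × X × Y | ε < |f (t.1, t.2.2) - f (t.2.1, t.2.2)|} :=
      isOpen_lt continuous_const (by fun_prop)
    have hmem := hopen.mem_nhds (x := (x, x₀, y)) hxy
    rw [nhds_prod_eq, nhds_prod_eq] at hmem
    obtain ⟨U, hU, T, hT, hUT⟩ := mem_prod_iff.1 hmem
    obtain ⟨W', hW', V, hV, hWV⟩ := mem_prod_iff.1 hT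
    refine ⟨interior (U ∩ W), interior V, ⟨W' ∩ W, inter_mem hW' hW⟩, isOpen_interior,
      ⟨x, mem_interior_iff_mem_nhds.2 (inter_mem hU hxW)⟩, isOpen_interior,
      ⟨y, mem_interior_iff_mem_nhds.2 hV⟩, interior_subset.trans Set.inter_subset_right,
      Set.inter_subset_right, fun u hu w hw v hv => ?_⟩
    exact hUT (Set.mk_mem_prod (interior_subset hu).1
      (hWV (Set.mk_mem_prod hw.1 (interior_subset hv))))
  choose U V W' hUo hUne hVo hVne hUW hW'W hsep using step
  let W : ℕ → {W : Set X // W ∈ 𝓝 x₀} := fun k => W'^[k] ⟨Set.univ, univ_mem⟩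
  have hWsucc : ∀ k, W (k + 1) = W' (W k) := fun k => Function.iterate_succ_apply' _ _ _
  have hanti : Antitone fun k => (W k).1 := antitone_nat_of_succ_le fun k => by
    rw [hWsucc]
    exact hW'W _
  obtain ⟨⟨a, b⟩, hab⟩ := exists_frequently_inter_nonempty hb (fun k => U (W k) ×ˢ V (W k))
    (fun k => (hUo _).prod (hVo _)) (fun k => (hUne _).prod (hVne _))
  have hnear : ∀ᶠ z in 𝓝 (a, b), |f z - f (a, b)| < ε / 2 :=
    hf.continuousAt.eventually (Metric.ball_mem_nhds _ (half_pos hε))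
  rw [nhds_prod_eq] at hnear
  obtain ⟨A, hA, B, hB, hAB⟩ := mem_prod_iff.1 hnear
  have hfreq := hab (A ×ˢ B) (prod_mem_nhds hA hB)
  obtain ⟨k, ⟨x', y'⟩, hk, hkN⟩ := hfreq.exists
  obtain ⟨l, ⟨⟨x, y⟩, hl, hlN⟩, hkl⟩ := (hfreq.and_eventually (eventually_gt_atTop k)).exists
  have hxW : x ∈ (W' (W k)).1 := by
    rw [← hWsucc]
    exact hanti hkl (hUW _ hl.1)
  have h1 := hsep (W k) x' hk.1 x hxW y' hk.2
  have h2 : |f (x', y') - f (a, b)| < ε / 2 := hAB hkN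
  have h3 : |f (x, y') - f (a, b)| < ε / 2 := hAB (Set.mk_mem_prod hlN.1 hkN.2)
  rw [abs_sub_comm] at h3
  have := abs_sub_le (f (x', y')) (f (a, b)) (f (x, y'))
  linarith

/-! ### One-sided inverses in topological semigroups -/

/-- If `p * q = 1`, multiplication by `q * p` fixes the powers of `p` of positive exponent, on the
right. -/
theorem pow_mul_mul_eq_pow {M : Type*} [Monoid M] {p q : M} (hpq : p * q = 1) {m : ℕ}
    (hm : 0 < m) : p ^ m * (q * p) = p ^ m := by
  obtain ⟨m, rfl⟩ := Nat.exists_eq_add_of_lt hm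
  rw [zero_add, pow_succ, mul_assoc, ← mul_assoc p q p, hpq, one_mul]

theorem pow_mul_pow_eq_pow_sub {M : Type*} [Monoid M] {p q : M} (hpq : p * q = 1) {k l : ℕ}
    (hkl : k ≤ l) : p ^ l * q ^ k = p ^ (l - k) := by
  conv_lhs => rw [← Nat.sub_add_cancel hkl, pow_add, mul_assoc, pow_mul_pow_eq_one k hpq, mul_one]

theorem map_pow_mem_positivePowers {M S : Type*} [Monoid M] [Semigroup S] (h : M →ₙ* S) (x : M)
    (k : ℕ) : h (x ^ (k + 1)) ∈ positivePowers (h x) := by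
  refine ⟨k, ?_⟩
  change (fun y => y * h x)^[k] (h x) = _
  induction k with
  | zero => simp
  | succ k ih => rw [Function.iterate_succ_apply', ih, ← map_mul, ← pow_succ]

section OneSidedInverse

variable {M S : Type*} [Monoid M] [Semigroup S] [TopologicalSpace S] [ContinuousMul S]
  {p q : M} (h : M →ₙ* S)

open Filter Topology in
/-- If the powers of `h p` and of `h q` converge along a common filter, to `a` and `b`, then
`h (q * p) = h 1`: `a * h (q ^ k)` is a limit of positive powers of `h p`, so it is fixed by
`h (q * p)`, and hence so is its limit `a * b = h 1`. -/
theorem map_mul_eq_map_one_of_tendsto_pow [T2Space S] (hpq : p * q = 1) {U : Filter ℕ} [U.NeBot]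
    (hU : U ≤ atTop) {a b : S} (ha : Tendsto (fun k => h (p ^ k)) U (𝓝 a))
    (hb : Tendsto (fun k => h (q ^ k)) U (𝓝 b)) : h (q * p) = h 1 := by
  have hab : a * b = h 1 := by
    refine tendsto_nhds_unique (ha.mul hb) ?_
    simp only [← map_mul, pow_mul_pow_eq_one _ hpq]
    exact tendsto_const_nhds
  have hfix : ∀ k, a * h (q ^ k) * h (q * p) = a * h (q ^ k) := by
    intro k
    have hlim := ha.mul_const (h (q ^ k))
    refine tendsto_nhds_unique (hlim.mul_const (h (q * p))) (hlim.congr' ?_)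
    filter_upwards [hU (eventually_gt_atTop k)] with l hl
    rw [← map_mul, ← map_mul, pow_mul_pow_eq_pow_sub hpq (le_of_lt hl),
      pow_mul_mul_eq_pow hpq (Nat.sub_pos_of_lt hl)]
  have hlim := hb.const_mul a
  have : a * b * h (q * p) = a * b :=
    tendsto_nhds_unique (hlim.mul_const (h (q * p))) (hlim.congr fun k => (hfix k).symm)
  rwa [hab, ← map_mul, one_mul] at this

/-- If `S × S` is a pseudocompact Tychonoff space and `φ : S → ℝ` is continuous, then
`x ↦ φ (x * ·)` is continuous for the uniform norm, so some powers `h (p ^ k)` and `h (p ^ l)` with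
`k < l` are close for it. Evaluation at `h (q ^ k)` and at `h (q ^ k * (q * p))` shows that
`φ (h 1)` and `φ (h (q * p))` are both close to `φ (h (p ^ (l - k)))`. -/
theorem map_mul_eq_map_one_of_isTychonoffPseudocompact (hS : IsTychonoffPseudocompact (S × S))
    (hpq : p * q = 1) : h (q * p) = h 1 := by
  by_contra hne
  have := hS.1
  -- A separating function on `S` comes from one on `S × S`, by restriction to a horizontal line.
  obtain ⟨g, hgc, hg0, hg1⟩ := CompletelyRegularSpace.completely_regular
    (h 1, h 1) {(h (q * p), h 1)} isClosed_singleton (fun hmem => hne (Prod.ext_iff.1 hmem).1.symm)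
  let φ : S → ℝ := fun x => g (x, h 1)
  have hφ : Continuous φ := by fun_prop
  have hφ0 : φ (h 1) = 0 := by simp [φ, hg0]
  have hφ1 : φ (h (q * p)) = 1 := by simp only [φ, hg1 rfl, Pi.one_apply, Set.Icc.coe_one]
  have hunif : ∀ x₀ : S, ∀ᶠ x in nhds x₀, ∀ y, |φ (x * y) - φ (x₀ * y)| ≤ 1 / 16 := fun x₀ =>
    eventually_forall_abs_sub_le hS (f := fun z => φ (z.1 * z.2)) (by fun_prop) x₀ (by norm_num)
  choose O hO hOo hmem using fun x₀ => eventually_nhds_iff.1 (hunif x₀)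
  obtain ⟨⟨c, d⟩, hcd⟩ := exists_frequently_inter_nonempty hS.2
    (fun k : ℕ => O (h (p ^ k)) ×ˢ (Set.univ : Set S)) (fun k => (hOo _).prod isOpen_univ)
    (fun k => ⟨(h (p ^ k), h 1), hmem _, trivial⟩)
  have hfreq := hcd (O c ×ˢ Set.univ) (prod_mem_nhds ((hOo c).mem_nhds (hmem c)) Filter.univ_mem)
  have hclose : ∀ k, (O (h (p ^ k)) ×ˢ (Set.univ : Set S) ∩ O c ×ˢ Set.univ).Nonempty →
      ∀ y, |φ (h (p ^ k) * y) - φ (c * y)| ≤ 1 / 8 := by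
    rintro k ⟨⟨x, _⟩, hx, hxc⟩ y
    have h1 := abs_le.1 (hO _ x hx.1 y)
    have h2 := abs_le.1 (hO _ x hxc.1 y)
    exact abs_le.2 ⟨by linarith [h1.2, h2.1], by linarith [h1.1, h2.2]⟩
  obtain ⟨k, hk⟩ := hfreq.exists
  obtain ⟨l, hl, hkl⟩ := (hfreq.and_eventually (Filter.eventually_gt_atTop k)).exists
  have hpow : ∀ r : M, |φ (h r) - φ (h (p ^ (l - k) * r))| ≤ 1 / 4 := by
    intro r
    have h1 := hclose k hk (h (q ^ k * r))
    have h2 := hclose l hl (h (q ^ k * r))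
    rw [← map_mul, ← mul_assoc, pow_mul_pow_eq_one k hpq, one_mul, abs_le] at h1
    rw [← map_mul, ← mul_assoc, pow_mul_pow_eq_pow_sub hpq hkl.le, abs_le] at h2
    exact abs_le.2 ⟨by linarith [h1.1, h2.2], by linarith [h1.2, h2.1]⟩
  have h1 := abs_le.1 (hpow 1)
  have h2 := abs_le.1 (hpow (q * p))
  rw [mul_one, hφ0] at h1
  rw [pow_mul_mul_eq_pow hpq (Nat.sub_pos_of_lt hkl), hφ1] at h2
  linarith [h1.1, h2.2]

open Filter Topology in
theorem map_mul_eq_map_one_of_isGammaCompact [T2Space S] (hS : IsGammaCompact S)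
    (hpq : p * q = 1) : h (q * p) = h 1 := by
  have hlim : ∀ x : M, ∃ c, Tendsto (fun k => h (x ^ k)) (hyperfilter ℕ) (𝓝 c) := by
    intro x
    have hev : ∀ᶠ k in (hyperfilter ℕ : Filter ℕ), h (x ^ k) ∈ closure (positivePowers (h x)) := by
      filter_upwards [Nat.hyperfilter_le_atTop (eventually_gt_atTop 0)] with k hk
      obtain ⟨k, rfl⟩ := Nat.exists_eq_add_of_lt hk
      rw [zero_add]
      exact subset_closure (map_pow_mem_positivePowers h x k)
    obtain ⟨c, -, hc⟩ := (hS (h x)).ultrafilter_le_nhds ((hyperfilter ℕ).map fun k => h (x ^ k))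
      (Filter.le_principal_iff.2 hev)
    exact ⟨c, hc⟩
  obtain ⟨a, ha⟩ := hlim p
  obtain ⟨b, hb⟩ := hlim q
  exact map_mul_eq_map_one_of_tendsto_pow h hpq Nat.hyperfilter_le_atTop ha hb

open Filter Topology in
theorem map_mul_eq_map_one_of_countablyCompact_inverse [T2Space S] [CountablyCompactSpace S]
    (hS : IsTopologicalInverse S) (hpq : p * q = 1) : h (q * p) = h 1 := by
  obtain ⟨huniq, inv, hinv, hcont⟩ := hS
  have hpow : ∀ k, inv (h (p ^ k)) = h (q ^ k) := by
    intro k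
    have hk := pow_mul_pow_eq_one k hpq
    refine (huniq (h (p ^ k))).unique (hinv _) ⟨?_, ?_⟩
    · rw [← map_mul, ← map_mul, hk, one_mul]
    · rw [← map_mul, ← map_mul, mul_assoc, hk, mul_one]
  obtain ⟨a, -, ha⟩ := CountablyCompactSpace.isCountablyCompact_univ.seq_clusterPt
    (fun k => h (p ^ k)) (by simp)
  obtain ⟨U, hU, haU⟩ := mapClusterPt_iff_ultrafilter.1 ha
  refine map_mul_eq_map_one_of_tendsto_pow h hpq hU haU
    (((hcont.tendsto a).comp haU).congr hpow)

open Filter Topology in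
theorem map_mul_eq_map_one_of_countablyCompact_prod [T2Space S] [CountablyCompactSpace (S × S)]
    (hpq : p * q = 1) : h (q * p) = h 1 := by
  obtain ⟨⟨a, b⟩, -, hab⟩ := CountablyCompactSpace.isCountablyCompact_univ.seq_clusterPt
    (fun k => (h (p ^ k), h (q ^ k))) (by simp)
  obtain ⟨U, hU, habU⟩ := mapClusterPt_iff_ultrafilter.1 hab
  exact map_mul_eq_map_one_of_tendsto_pow h hpq hU
    ((continuous_fst.tendsto _).comp habU) ((continuous_snd.tendsto _).comp habU)

end OneSidedInverse

/-! ### Generators and inverses in `IPF n` -/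

namespace IPF

variable {n : ℕ}

theorem ext_mem {α β : IPF n} (h : ∀ z w, w ∈ α.1 z ↔ w ∈ β.1 z) : α = β :=
  Subtype.ext (PEquiv.ext fun z => Option.ext (h z))

theorem isFilterIso_refl : IsFilterIso (PEquiv.refl (Fin n → ℕ+)) := by
  refine ⟨⟨1, fun z => ?_⟩, ⟨1, fun w => ?_⟩, fun z z' w w' hw hw' => ?_⟩
  · simpa using show (1 : Fin n → ℕ+) ≤ z from fun i => one_le
  · simpa using show (1 : Fin n → ℕ+) ≤ w from fun i => one_le
  · obtain rfl : z = w := by simpa using hw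
    obtain rfl : z' = w' := by simpa using hw'
    rfl

/-- `IPF n` is a monoid, with the identity map of `ℕ+ ^ n` as its identity. This is a local instance
only, so that the multiplication of `IPF n` is found through `IPF.instSemigroup` elsewhere. -/
@[reducible]
def monoid (n : ℕ) : Monoid (IPF n) where
  toSemigroup := instSemigroup n
  one := ⟨PEquiv.refl _, isFilterIso_refl⟩
  one_mul α := Subtype.ext (PEquiv.refl_trans α.1)
  mul_one α := Subtype.ext (PEquiv.trans_refl α.1)

attribute [local instance] monoid

theorem mem_one_iff (z w : Fin n → ℕ+) : w ∈ (1 : IPF n).1 z ↔ z = w := by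
  change w ∈ PEquiv.refl _ z ↔ z = w
  simp

/-- The inverse partial map. -/
def symm (α : IPF n) : IPF n :=
  ⟨α.1.symm, by
    obtain ⟨⟨x, hx⟩, ⟨y, hy⟩, h⟩ := α.2
    simp only [IsFilterIso, PEquiv.mem_iff_mem]
    exact ⟨⟨y, hy⟩, ⟨x, hx⟩, fun z z' w w' hw hw' => (h w w' z z' hw hw').symm⟩⟩

theorem mem_symm_iff (α : IPF n) (z w : Fin n → ℕ+) : w ∈ α.symm.1 z ↔ z ∈ α.1 w :=
  α.1.mem_iff_mem

theorem mem_mul_symm_iff (α : IPF n) (z w : Fin n → ℕ+) :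
    w ∈ (α * α.symm).1 z ↔ z = w ∧ α.src ≤ z := by
  simp only [mul_mem_iff, mem_symm_iff, ← mem_dom_iff]
  constructor
  · rintro ⟨m, hz, hw⟩
    exact ⟨α.1.inj hz hw, m, hz⟩
  · rintro ⟨rfl, m, hm⟩
    exact ⟨m, hm, hm⟩

theorem symm_symm (α : IPF n) : α.symm.symm = α := rfl

theorem eq_of_forall_le_iff {x y : Fin n → ℕ+} (h : ∀ z, x ≤ z ↔ y ≤ z) : x = y :=
  le_antisymm ((h y).2 le_rfl) ((h x).1 le_rfl)

theorem src_symm (α : IPF n) : α.symm.src = α.tgt :=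
  eq_of_forall_le_iff fun z => by simp only [← mem_dom_iff, ← mem_ran_iff, mem_symm_iff]

theorem mem_symm_mul_iff (α : IPF n) (z w : Fin n → ℕ+) :
    w ∈ (α.symm * α).1 z ↔ z = w ∧ α.tgt ≤ z := by
  have h := mem_mul_symm_iff α.symm z w
  rwa [symm_symm, src_symm] at h

open scoped Classical in
/-- The map `z ↦ (z - x)σ + y`, defined for `x ≤ z`. -/
noncomputable def affineFun (x y : Fin n → ℕ+) (σ : Equiv.Perm (Fin n)) (z : Fin n → ℕ+) :
    Option (Fin n → ℕ+) :=
  if x ≤ z then some (shift y (permVec (fun j => (z j : ℕ) - (x j : ℕ)) σ)) else none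

theorem mem_affineFun_iff (x y : Fin n → ℕ+) (σ : Equiv.Perm (Fin n)) (z w : Fin n → ℕ+) :
    w ∈ affineFun x y σ z ↔ x ≤ z ∧ y ≤ w ∧
      ∀ i, (w i : ℤ) - y i = (z (σ.symm i) : ℤ) - x (σ.symm i) := by
  by_cases hxz : x ≤ z
  · have hle : ∀ i, (x i : ℕ) ≤ z i := hxz
    simp only [affineFun, hxz, if_true, Option.mem_def, Option.some_inj, true_and]
    constructor
    · rintro rfl
      refine ⟨le_shift _ _, fun i => ?_⟩
      have := hle (σ.symm i)
      simp only [shift, permVec, PNat.mk_coe]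
      omega
    · rintro ⟨hyw, hw⟩
      funext i
      have h1 := hle (σ.symm i)
      have h2 : (y i : ℕ) ≤ w i := hyw i
      have h3 := hw i
      apply PNat.coe_injective
      simp only [shift, permVec, PNat.mk_coe]
      omega
  · simp [affineFun, hxz]

theorem mem_affineFun_symm_iff (x y : Fin n → ℕ+) (σ : Equiv.Perm (Fin n)) (z w : Fin n → ℕ+) :
    z ∈ affineFun y x σ.symm w ↔ w ∈ affineFun x y σ z := by
  rw [mem_affineFun_iff, mem_affineFun_iff, and_left_comm, ← σ.symm.forall_congr_right]
  simp only [Equiv.symm_symm, Equiv.apply_symm_apply, eq_comm]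

theorem exists_mem_affineFun (x y : Fin n → ℕ+) (σ : Equiv.Perm (Fin n)) (z : Fin n → ℕ+) :
    (∃ w, w ∈ affineFun x y σ z) ↔ x ≤ z := by
  simp [affineFun]

/-- The order isomorphism `z ↦ (z - x)σ + y` from `{z | x ≤ z}` onto `{w | y ≤ w}`. -/
noncomputable def ofPerm (x y : Fin n → ℕ+) (σ : Equiv.Perm (Fin n)) : IPF n where
  val :=
    { toFun := affineFun x y σ
      invFun := affineFun y x σ.symm
      inv := fun z w => mem_affineFun_symm_iff x y σ z w }
  property := by
    refine ⟨⟨x, exists_mem_affineFun x y σ⟩, ⟨y, fun w => ?_⟩, fun z z' w w' hw hw' => ?_⟩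
    · rw [← exists_mem_affineFun y x σ.symm w]
      exact exists_congr fun z => (mem_affineFun_symm_iff x y σ z w).symm
    · obtain ⟨-, -, h⟩ := (mem_affineFun_iff x y σ z w).1 hw
      obtain ⟨-, -, h'⟩ := (mem_affineFun_iff x y σ z' w').1 hw'
      simp only [Pi.le_def, ← PNat.coe_le_coe]
      rw [← σ.symm.forall_congr_right]
      refine forall_congr' fun i => ?_
      have := h i
      have := h' i
      omega

theorem mem_ofPerm_iff (x y : Fin n → ℕ+) (σ : Equiv.Perm (Fin n)) (z w : Fin n → ℕ+) :
    w ∈ (ofPerm x y σ).1 z ↔ x ≤ z ∧ y ≤ w ∧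
      ∀ i, (w i : ℤ) - y i = (z (σ.symm i) : ℤ) - x (σ.symm i) :=
  mem_affineFun_iff x y σ z w

theorem src_ofPerm (x y : Fin n → ℕ+) (σ : Equiv.Perm (Fin n)) : (ofPerm x y σ).src = x :=
  eq_of_forall_le_iff fun z => by
    rw [← mem_dom_iff]
    exact exists_mem_affineFun x y σ z

theorem tgt_ofPerm (x y : Fin n → ℕ+) (σ : Equiv.Perm (Fin n)) : (ofPerm x y σ).tgt = y := by
  rw [← src_symm]
  exact src_ofPerm y x σ.symm

theorem upsilon_ofPerm (x y : Fin n → ℕ+) (σ : Equiv.Perm (Fin n)) :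
    upsilon n (ofPerm x y σ) = ⟨σ, permVec (fun j => (x j : ℤ)) σ - fun j => (y j : ℤ)⟩ := by
  have hσ : σ = (ofPerm x y σ).perm :=
    perm_unique _ (c := fun i => (x (σ.symm i) : ℤ) - y i) fun z w hw i => by
      have := ((mem_ofPerm_iff x y σ z w).1 hw).2.2 i
      omega
  change upsilonFun _ = _
  rw [upsilonFun, src_ofPerm, tgt_ofPerm, ← hσ]

theorem upsilon_surjective : Function.Surjective (upsilon n) := by
  rintro ⟨σ, v⟩
  -- Writing `v = v⁺ - v⁻`, the vectors `(x)σ = v⁺ + 1` and `y = v⁻ + 1` are positive.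
  refine ⟨ofPerm (shift 1 fun j => (v (σ j)).toNat) (shift 1 fun i => (-v i).toNat) σ, ?_⟩
  rw [upsilon_ofPerm]
  refine SymZ.ext rfl (funext fun i => ?_)
  simp only [permVec, shift, Pi.sub_apply, PNat.mk_coe, Equiv.apply_symm_apply, Pi.one_apply,
    PNat.one_coe]
  omega

/-- An element of `IPF n` is determined by the generator of its domain and its image under `Υ`. -/
theorem mem_iff_upsilon (α : IPF n) (z w : Fin n → ℕ+) :
    w ∈ α.1 z ↔ α.src ≤ z ∧
      ∀ i, (w i : ℤ) = (z ((upsilon n α).perm.symm i) : ℤ) - (upsilon n α).vec i := by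
  refine ⟨fun hw => ⟨(mem_dom_iff α z).1 ⟨w, hw⟩, α.upsilonFun_spec hw⟩, ?_⟩
  rintro ⟨hz, hw⟩
  obtain ⟨w', hw'⟩ := (mem_dom_iff α z).2 hz
  convert hw'
  funext i
  apply PNat.coe_injective
  have h1 := hw i
  have h2 : _ = (z ((upsilon n α).perm.symm i) : ℤ) - _ := α.upsilonFun_spec hw' i
  exact Int.ofNat_inj.1 (h1.trans h2.symm)

/-! ### Homomorphisms that send one-sided inverses to two-sided ones -/

section Hom

variable {S : Type*} [Semigroup S] {h : IPF n →ₙ* S}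

/-- If `h` sends one-sided inverses to two-sided ones, it sends every idempotent to `h 1`: with `p`
the translation of `ℕ+ ^ n` onto the domain of `α`, the idempotent `α * α.symm` is `p.symm * p`,
while `p * p.symm = 1`. -/
theorem map_mul_symm (H : ∀ p q : IPF n, p * q = 1 → h (q * p) = h 1) (α : IPF n) :
    h (α * α.symm) = h 1 := by
  let p : IPF n := ofPerm 1 α.src (Equiv.refl _)
  have h1 : p * p.symm = 1 := ext_mem fun z w => by
    rw [mem_mul_symm_iff, mem_one_iff, src_ofPerm]
    exact and_iff_left fun i => one_le
  have h2 : p.symm * p = α * α.symm := ext_mem fun z w => by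
    rw [mem_mul_symm_iff, mem_symm_mul_iff, tgt_ofPerm]
  rw [← h2, H _ _ h1]

theorem map_eq_of_upsilon_eq (H : ∀ p q : IPF n, p * q = 1 → h (q * p) = h 1) {α β : IPF n}
    (hαβ : upsilon n α = upsilon n β) : h α = h β := by
  -- `α` and `β` agree on the intersection of their domains, which is a principal filter.
  let γ : IPF n := ofPerm (α.src ⊔ β.src) 1 (Equiv.refl _)
  have hmem : ∀ (δ : IPF n) z w, w ∈ (γ * γ.symm * δ).1 z ↔ α.src ⊔ β.src ≤ z ∧ w ∈ δ.1 z := by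
    intro δ z w
    simp only [mul_mem_iff (γ * γ.symm), mem_mul_symm_iff]
    rw [src_ofPerm]
    aesop
  have hγ : γ * γ.symm * α = γ * γ.symm * β := ext_mem fun z w => by
    rw [hmem, hmem, mem_iff_upsilon α, mem_iff_upsilon β, hαβ]
    exact and_congr_right fun hz => by simp [le_sup_left.trans hz, le_sup_right.trans hz]
  have hδ : ∀ δ : IPF n, h (γ * γ.symm * δ) = h δ := fun δ => by
    rw [map_mul, map_mul_symm H, ← map_mul, one_mul]
  rw [← hδ α, hγ, hδ]

theorem isSubgroupOf_srange (H : ∀ p q : IPF n, p * q = 1 → h (q * p) = h 1) :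
    IsSubgroupOf (MulHom.srange h) := by
  refine ⟨h 1, ⟨1, rfl⟩, ?_⟩
  rintro _ ⟨α, rfl⟩
  refine ⟨by rw [← map_mul, one_mul], by rw [← map_mul, mul_one], h α.symm, ⟨α.symm, rfl⟩, ?_, ?_⟩
  · rw [← map_mul, map_mul_symm H]
  · rw [← map_mul]
    exact map_mul_symm H α.symm

theorem existsUnique_comp_upsilon (H : ∀ p q : IPF n, p * q = 1 → h (q * p) = h 1) :
    ∃! u : SymZ n →ₙ* S, u.comp (upsilon n) = h := by
  let s := Function.surjInv (upsilon_surjective (n := n))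
  have hs : ∀ g, upsilon n (s g) = g := Function.surjInv_eq _
  refine ⟨⟨fun g => h (s g), fun a b => ?_⟩, ?_, fun u hu => ?_⟩
  · rw [← map_mul]
    exact map_eq_of_upsilon_eq H (by rw [map_mul, hs, hs, hs])
  · ext α
    exact map_eq_of_upsilon_eq H (hs _)
  · ext g
    change u g = h (s g)
    rw [← hu, MulHom.comp_apply, hs]

end Hom

theorem map_mul_eq_map_one {S : Type*} [Semigroup S] [TopologicalSpace S] [T2Space S]
    [ContinuousMul S]
    (hS : CompactSpace S ∨
      IsGammaCompact S ∨
      (CountablyCompactSpace S ∧ IsTopologicalInverse S) ∨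
      CountablyCompactSpace (S × S) ∨
      IsTychonoffPseudocompact (S × S)) (h : IPF n →ₙ* S) (p q : IPF n) (hpq : p * q = 1) :
    h (q * p) = h 1 := by
  rcases hS with hS | hS | ⟨hS, hinv⟩ | hS | hS
  · exact map_mul_eq_map_one_of_isGammaCompact h (fun x => isClosed_closure.isCompact) hpq
  · exact map_mul_eq_map_one_of_isGammaCompact h hS hpq
  · exact map_mul_eq_map_one_of_countablyCompact_inverse h hinv hpq
  · exact map_mul_eq_map_one_of_countablyCompact_prod h hpq
  · exact map_mul_eq_map_one_of_isTychonoffPseudocompact h hS hpq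

/-- For `1 ≤ n` the map `Υ` is not injective: it sends all the identity maps of principal filters
to the same element. -/
theorem upsilon_not_injective (hn : 1 ≤ n) : ¬ Function.Injective (upsilon n) := by
  intro hinj
  have h := @hinj (ofPerm 1 1 (Equiv.refl _)) (ofPerm 2 2 (Equiv.refl _)) (by
    rw [upsilon_ofPerm, upsilon_ofPerm]
    refine SymZ.ext rfl (funext fun i => ?_)
    simp [permVec])
  have h12 := congrFun (congrArg src h) ⟨0, hn⟩
  rw [src_ofPerm, src_ofPerm] at h12
  exact absurd h12 (show (1 : ℕ+) ≠ 2 by decide)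

end IPF

theorem corollary3p4 (n : ℕ) (hn : 1 ≤ n) (S : Type*) [Semigroup S] [TopologicalSpace S]
    [T2Space S] [ContinuousMul S]
    (hS : CompactSpace S ∨
      IsGammaCompact S ∨
      (CountablyCompactSpace S ∧ IsTopologicalInverse S) ∨
      CountablyCompactSpace (S × S) ∨
      IsTychonoffPseudocompact (S × S)) :
    (¬ ∃ T : Subsemigroup S, Nonempty (IPF n ≃* T)) ∧
    (∀ h : IPF n →ₙ* S, IsSubgroupOf (MulHom.srange h)) ∧
    (∀ h : IPF n →ₙ* S, ∃! u : SymZ n →ₙ* S, u.comp (IPF.upsilon n) = h) := by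
  have H := IPF.map_mul_eq_map_one (n := n) hS
  refine ⟨?_, fun h => IPF.isSubgroupOf_srange (H h),
    fun h => IPF.existsUnique_comp_upsilon (H h)⟩
  rintro ⟨T, ⟨φ⟩⟩
  let h : IPF n →ₙ* S := (MulMemClass.subtype T).comp (φ : IPF n →ₙ* T)
  exact IPF.upsilon_not_injective hn fun α β hαβ =>
    φ.injective (Subtype.ext (IPF.map_eq_of_upsilon_eq (H h) hαβ))
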